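/- Let $d\in\mathbb{N}$, $0<\alpha<d$, and let $p,q,r$ be exponents with $$1<p,\,q<\frac{d}{\alpha}\qquad\text{and}\qquad \frac1p+\frac1q=\frac1r+\frac{\alpha}{d}.$$ (Then $\alpha/d<1/r<2-\alpha/d$, so that $0<r<\infty$; $r<1$ is allowed, in which case $\|h\|_{L^r}=(\int|h|^r)^{1/r}$ is a quasi-norm.) For $\theta\in[0,1]$ and functions $f,g$ on $\mathbb{R}^d$ put $$I_\alpha^\theta(f,g)(x)=\int_{\mathbb{R}^d} f\big(x+(\theta-1)y\big)\,g(x+\theta y)\,|y|^{\alpha-d}\,\mathrm{d}y .$$ Then there is a constant $C=C(\alpha,d,p,q)>0$, independent of $\theta$, such that for all $\theta\in[0,1]$, all $f\in L^p(\mathbb{R}^d)$ and all $g\in L^q(\mathbb{R}^d)$ we have $I_\alpha^\theta(f,g)\in L^r(\mathbb{R}^d)$ and $$\|I_\alpha^\theta(f,g)\|_{L^r(\mathbb{R}^d)}\le C\,\|f\|_{L^p(\mathbb{R}^d)}\,\|g\|_{L^q(\mathbb{R}^d)} .$$ This holds for nonnegative (possibly extended-valued) $f$ and $g$, for which the integral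 is always defined in $[0,\infty]$, and for real- or complex-valued $f$ and $g$, for which the integral converges absolutely for almost every $x\in\mathbb{R}^d$. -/

import Mathlib

open MeasureTheory
open scoped ENNReal

/-- The bilinear fractional integral
`I_α^θ(f,g)(x) = ∫ f(x + (θ-1)y) g(x + θy) |y|^(α-d) dy` on `ℝ^d` for nonnegative (extended-valued)
functions `f` and `g`. It is always defined, possibly with the value `∞`. -/
noncomputable def lbilinFracInt {d : ℕ} (α θ : ℝ) (f g : EuclideanSpace ℝ (Fin d) → ℝ≥0∞)
    (x : EuclideanSpace ℝ (Fin d)) : ℝ≥0∞ :=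
  ∫⁻ y, f (x + (θ - 1) • y) * g (x + θ • y) * ‖y‖ₑ ^ (α - d)

/-- The integrand `y ↦ f(x + (θ-1)y) g(x + θy) |y|^(α-d)` for scalar-valued `f` and `g`. -/
noncomputable def bilinFracIntegrand {𝕜 : Type*} [RCLike 𝕜] {d : ℕ} (α θ : ℝ)
    (f g : EuclideanSpace ℝ (Fin d) → 𝕜) (x y : EuclideanSpace ℝ (Fin d)) : 𝕜 :=
  f (x + (θ - 1) • y) * g (x + θ • y) * ((‖y‖ ^ (α - d) : ℝ) : 𝕜)

/-- The bilinear fractional integral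
`I_α^θ(f,g)(x) = ∫ f(x + (θ-1)y) g(x + θy) |y|^(α-d) dy` on `ℝ^d` for real- or complex-valued `f`
and `g`. It is meaningful at the points `x` at which the integrand is integrable. -/
noncomputable def bilinFracInt {𝕜 : Type*} [RCLike 𝕜] {d : ℕ} (α θ : ℝ)
    (f g : EuclideanSpace ℝ (Fin d) → 𝕜) (x : EuclideanSpace ℝ (Fin d)) : 𝕜 :=
  ∫ y, bilinFracIntegrand α θ f g x y

/-!
The constant is uniform in `θ` because `θ` disappears after localization to a dyadic scale. Replace
the kernel by `∑ k, 2 ^ (k * α)` times the normalised indicator function of the ball of radius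
`2 ^ k`; this bounds the bilinear integral by `∑ k, 2 ^ (k * α) * A k`, where `A k` is the bilinear
average `bilinAvg` of `f` and `g`. Averaging `A k` once more over a ball of radius `2 ^ k` gives,
by a shear of `E × E` that preserves the measure, at most a constant times the product of the
averages of `f` and of `g` over a ball of twice the radius (`ballAvg_bilinAvg_le`). For an exponent
`s ≤ 1`, Jensen's inequality therefore controls `∫ A k ^ s` by such products
(`lintegral_bilinAvg_rpow_le`).

The exponent `r` may exceed one, but always `r < min p q`. With `t = max 1 r`, the pointwise bound
`A k (f, g) ^ t ≤ A k (f ^ t, g ^ t)` reduces matters to the exponents `p / t`, `q / t > 1` and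
`r / t ≤ 1`. Hölder's inequality then leaves linear estimates
`∑ k, ∫ (2 ^ (k * a) * ballAvg f k) ^ s ≤ C * ‖f‖_p ^ s` with `a = n * (1 / p - 1 / s) > 0`, where
`n` is the dimension (`exists_tsum_lintegral_ballAvg_rpow_le`). The result is a bound for
`∑ k, ∫ (2 ^ (k * α) * A k) ^ r` (`exists_tsum_lintegral_bilinAvg_rpow_le`).

To pass from this `ℓ^r` sum to the sum `∑ k, 2 ^ (k * α) * A k`, perturb `α` to `α ± ε`, and `r`
accordingly. At every point, `2 ^ (k * α) * A k` is at most `2 ^ (k * ε)` times the `ℓ^s` norm of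
the sequence for `α - ε`, and at most `2 ^ (-k * ε)` times the `ℓ^u` norm of the one for `α + ε`,
where `s` and `u` are the perturbed exponents. So its sum over `k` is at most a constant times the
geometric mean of these two norms (`exists_tsum_le_rpow_mul_rpow`), and Hölder's inequality
concludes.

Almost everywhere defined functions need some care: for `θ = 0` and `θ = 1` one of the arguments
does not depend on `y`, so changing `f` and `g` on a null set may change the integral at some
points `x`, but only on a null set of them (`ae_ae_eq_comp_add_smul`).
-/

section Auxiliary

open Metric Module ProbabilityTheory

/-! ### Geometric sums and inequalities for integrals -/

section Scalar

lemma two_rpow_ne_zero (x : ℝ) : (2 : ℝ≥0∞) ^ x ≠ 0 :=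
  (ENNReal.rpow_pos (by norm_num) (by norm_num)).ne'

lemma two_rpow_ne_top (x : ℝ) : (2 : ℝ≥0∞) ^ x ≠ ∞ :=
  ENNReal.rpow_ne_top_of_ne_zero (by norm_num) (by norm_num)

lemma two_rpow_add (x y : ℝ) : (2 : ℝ≥0∞) ^ (x + y) = 2 ^ x * 2 ^ y :=
  ENNReal.rpow_add _ _ (by norm_num) (by norm_num)

lemma tsum_two_rpow_neg_ne_top {b : ℝ} (hb : 0 < b) :
    ∑' n : ℕ, (2 : ℝ≥0∞) ^ (-(n : ℝ) * b) ≠ ∞ := by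
  have h : ∀ n : ℕ, (2 : ℝ≥0∞) ^ (-(n : ℝ) * b) = (2 ^ (-b)) ^ n := fun n => by
    rw [← ENNReal.rpow_natCast, ← ENNReal.rpow_mul]; congr 1; ring
  simp_rw [h, ENNReal.tsum_geometric]
  refine ENNReal.inv_ne_top.2 (tsub_pos_of_lt ?_).ne'
  exact ENNReal.rpow_lt_one_of_one_lt_of_neg (by norm_num) (by linarith)

lemma tsum_min_two_rpow_ne_top {a b : ℝ} (ha : 0 < a) (hb : 0 < b) :
    ∑' j : ℤ, min ((2 : ℝ≥0∞) ^ (j * a)) (2 ^ (-j * b)) ≠ ∞ := by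
  rw [tsum_of_nat_of_neg_add_one ENNReal.summable ENNReal.summable]
  refine ENNReal.add_ne_top.2 ⟨?_, ?_⟩
  · refine ne_top_of_le_ne_top (tsum_two_rpow_neg_ne_top hb) (ENNReal.tsum_le_tsum fun n => ?_)
    simp
  · refine ne_top_of_le_ne_top (tsum_two_rpow_neg_ne_top ha) (ENNReal.tsum_le_tsum fun n => ?_)
    refine (min_le_left _ _).trans (ENNReal.rpow_le_rpow_of_exponent_le (by norm_num) ?_)
    push_cast
    nlinarith

/-- Summing the smaller of an increasing and a decreasing geometric sequence over all scales costs
only a constant times the value at which the two sequences cross. -/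
lemma exists_tsum_min_geometric_le {a b : ℝ} (ha : 0 < a) (hb : 0 < b) :
    ∃ C : ℝ≥0∞, C ≠ ∞ ∧ ∀ X Y : ℝ≥0∞,
      ∑' k : ℤ, min (X * 2 ^ (k * a)) (Y * 2 ^ (-k * b)) ≤
        C * (X ^ (b / (a + b)) * Y ^ (a / (a + b))) := by
  have hab : 0 < a + b := by linarith
  have hta : 0 < a / (a + b) := by positivity
  have htb : 0 < b / (a + b) := by positivity
  set K := ∑' j : ℤ, min ((2 : ℝ≥0∞) ^ (j * a)) (2 ^ (-j * b)) with hK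
  have hKtop : K ≠ ∞ := tsum_min_two_rpow_ne_top ha hb
  have hK0 : K ≠ 0 := by
    intro h
    have := ENNReal.tsum_eq_zero.1 h 0
    simp at this
  refine ⟨2 ^ b * K, ENNReal.mul_ne_top (two_rpow_ne_top b) hKtop, fun X Y => ?_⟩
  have hC0 : 2 ^ b * K ≠ 0 := mul_ne_zero (two_rpow_ne_zero b) hK0
  rcases eq_or_ne X 0 with rfl | hX0
  · simp
  rcases eq_or_ne Y 0 with rfl | hY0
  · simp
  rcases eq_or_ne X ∞ with rfl | hX
  · rw [ENNReal.top_rpow_of_pos htb, ENNReal.top_mul (by simp [hY0, hta.not_gt]),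
      ENNReal.mul_top hC0]
    exact le_top
  rcases eq_or_ne Y ∞ with rfl | hY
  · rw [ENNReal.top_rpow_of_pos hta, ENNReal.mul_top (by simp [hX0, htb.not_gt]),
      ENNReal.mul_top hC0]
    exact le_top
  -- `s` is the scale at which the two sequences cross, and `2 ^ L` its dyadic approximation.
  set s : ℝ≥0∞ := (Y / X) ^ (1 / (a + b)) with hs
  set M := X ^ (b / (a + b)) * Y ^ (a / (a + b)) with hM
  have hYX0 : Y / X ≠ 0 := ENNReal.div_ne_zero.2 ⟨hY0, hX⟩
  have hYX : Y / X ≠ ∞ := ENNReal.div_ne_top hY hX0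
  have hs0 : s ≠ 0 := (ENNReal.rpow_pos (pos_iff_ne_zero.2 hYX0) hYX).ne'
  have hst : s ≠ ∞ := ENNReal.rpow_ne_top_of_ne_zero hYX0 hYX
  have hXs : X * s ^ a = M := by
    rw [hs, ← ENNReal.rpow_mul, ENNReal.div_eq_inv_mul,
      ENNReal.mul_rpow_of_nonneg _ _ (by positivity), ENNReal.inv_rpow, ← ENNReal.rpow_neg,
      ← mul_assoc, hM]
    nth_rw 1 [← ENNReal.rpow_one X]
    rw [← ENNReal.rpow_add _ _ hX0 hX]
    congr 2 <;> field_simp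
    ring
  have hYs : Y * s ^ (-b) = M := by
    rw [hs, ← ENNReal.rpow_mul, ENNReal.div_eq_inv_mul, ENNReal.mul_rpow_of_ne_zero
      (ENNReal.inv_ne_zero.2 hX) hY0, ENNReal.inv_rpow, ← ENNReal.rpow_neg, mul_left_comm, hM]
    nth_rw 1 [← ENNReal.rpow_one Y]
    rw [← ENNReal.rpow_add _ _ hY0 hY]
    congr 2 <;> field_simp
    ring
  obtain ⟨L, hL1, hL2⟩ := ENNReal.exists_mem_Ico_zpow hs0 hst ENNReal.one_lt_two (by norm_num)
  rw [← ENNReal.rpow_intCast] at hL1 hL2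
  rw [← (Equiv.addLeft L).tsum_eq]
  calc ∑' j : ℤ, min (X * 2 ^ (((L + j : ℤ) : ℝ) * a)) (Y * 2 ^ (-((L + j : ℤ) : ℝ) * b))
      ≤ ∑' j : ℤ, M * 2 ^ b * min ((2 : ℝ≥0∞) ^ (j * a)) (2 ^ (-j * b)) := by
        refine ENNReal.tsum_le_tsum fun j => ?_
        have h1 : X * 2 ^ (((L + j : ℤ) : ℝ) * a) ≤ M * 2 ^ b * 2 ^ (j * a) := by
          have : ((2 : ℝ≥0∞) ^ ((L : ℝ) * a)) ≤ s ^ a := by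
            rw [ENNReal.rpow_mul]; exact ENNReal.rpow_le_rpow hL1 ha.le
          calc X * 2 ^ (((L + j : ℤ) : ℝ) * a) = X * 2 ^ ((L : ℝ) * a) * 2 ^ (j * a) := by
                rw [mul_assoc, ← two_rpow_add]; push_cast; ring_nf
            _ ≤ M * 2 ^ (j * a) := by rw [← hXs]; gcongr
            _ ≤ M * 2 ^ b * 2 ^ (j * a) := by
                gcongr
                exact le_mul_of_one_le_right' (ENNReal.one_le_rpow (by norm_num) hb)
        have h2 : Y * 2 ^ (-((L + j : ℤ) : ℝ) * b) ≤ M * 2 ^ b * 2 ^ (-j * b) := by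
          have : ((2 : ℝ≥0∞) ^ (-((L + 1 : ℤ) : ℝ) * b)) ≤ s ^ (-b) := by
            rw [neg_mul, ENNReal.rpow_neg, ENNReal.rpow_neg, ENNReal.rpow_mul]
            exact ENNReal.inv_le_inv.2 (ENNReal.rpow_le_rpow hL2.le hb.le)
          calc Y * 2 ^ (-((L + j : ℤ) : ℝ) * b)
              = Y * 2 ^ (-((L + 1 : ℤ) : ℝ) * b) * 2 ^ b * 2 ^ (-j * b) := by
                rw [mul_assoc, mul_assoc, ← two_rpow_add, ← two_rpow_add]; push_cast; ring_nf
            _ ≤ M * 2 ^ b * 2 ^ (-j * b) := by rw [← hYs]; gcongr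
        rw [← min_mul_mul_left]
        exact min_le_min h1 h2
    _ = 2 ^ b * K * M := by rw [ENNReal.tsum_mul_left]; ring

/-- Jensen's inequality for the powers `t ≥ 1`. -/
lemma rpow_lintegral_le_lintegral_rpow {Ω : Type*} [MeasurableSpace Ω] {ν : Measure Ω}
    [IsProbabilityMeasure ν] {f : Ω → ℝ≥0∞} (hf : AEMeasurable f ν) {t : ℝ} (ht : 1 ≤ t) :
    (∫⁻ x, f x ∂ν) ^ t ≤ ∫⁻ x, f x ^ t ∂ν := by
  have h := eLpNorm'_le_eLpNorm'_of_exponent_le one_pos ht ν hf.aestronglyMeasurable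
  simp only [eLpNorm', enorm_eq_self, ENNReal.rpow_one, div_one] at h
  calc _ ≤ ((∫⁻ x, f x ^ t ∂ν) ^ (1 / t)) ^ t := ENNReal.rpow_le_rpow h (by linarith)
    _ = _ := by rw [← ENNReal.rpow_mul, one_div_mul_cancel (by linarith), ENNReal.rpow_one]

/-- Jensen's inequality for the powers `0 < s ≤ 1`. -/
lemma lintegral_rpow_le_rpow_lintegral {Ω : Type*} [MeasurableSpace Ω] {ν : Measure Ω}
    [IsProbabilityMeasure ν] {f : Ω → ℝ≥0∞} (hf : AEMeasurable f ν) {s : ℝ} (hs : 0 < s)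
    (hs1 : s ≤ 1) : ∫⁻ x, f x ^ s ∂ν ≤ (∫⁻ x, f x ∂ν) ^ s := by
  have h := eLpNorm'_le_eLpNorm'_of_exponent_le hs hs1 ν hf.aestronglyMeasurable
  simp only [eLpNorm', enorm_eq_self, ENNReal.rpow_one, div_one] at h
  calc _ = ((∫⁻ x, f x ^ s ∂ν) ^ (1 / s)) ^ s := by
        rw [← ENNReal.rpow_mul, one_div_mul_cancel hs.ne', ENNReal.rpow_one]
    _ ≤ _ := ENNReal.rpow_le_rpow h hs.le

/-- Hölder's inequality on `ℤ × Ω`, with `1 / r = 1 / p + 1 / q` and `r` possibly less than one. -/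
lemma tsum_lintegral_mul_rpow_le {Ω : Type*} [MeasurableSpace Ω] {μ : Measure Ω} [SFinite μ]
    {p q r : ℝ} (hr : 0 < r) (hp : 0 < p) (hq : 0 < q) (h : 1 / r = 1 / p + 1 / q)
    {F G : ℤ → Ω → ℝ≥0∞} (hF : ∀ k, Measurable (F k)) (hG : ∀ k, Measurable (G k)) :
    ∑' k, ∫⁻ x, (F k x * G k x) ^ r ∂μ ≤
      (∑' k, ∫⁻ x, F k x ^ p ∂μ) ^ (r / p) * (∑' k, ∫⁻ x, G k x ^ q ∂μ) ^ (r / q) := by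
  have key : ∀ H : ℤ → Ω → ℝ≥0∞, (∀ k, Measurable (H k)) →
      ∑' k, ∫⁻ x, H k x ∂μ = ∫⁻ z, H z.1 z.2 ∂(Measure.count.prod μ) := fun H hH => by
    rw [lintegral_prod _ (measurable_from_prod_countable_right hH).aemeasurable, lintegral_count]
  have hrp : r < p := by
    have : 0 < 1 / q := by positivity
    exact (one_div_lt_one_div hp hr).1 (by linarith)
  rw [key (fun k x => (F k x * G k x) ^ r) fun k => ((hF k).mul (hG k)).pow_const r,
    key (fun k x => F k x ^ p) fun k => (hF k).pow_const p,
    key (fun k x => G k x ^ q) fun k => (hG k).pow_const q]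
  have h1 := ENNReal.lintegral_Lp_mul_le_Lq_mul_Lr hr hrp h (Measure.count.prod μ)
    (f := fun z => F z.1 z.2) (g := fun z => G z.1 z.2)
    (measurable_from_prod_countable_right hF).aemeasurable
    (measurable_from_prod_countable_right hG).aemeasurable
  have h2 := ENNReal.rpow_le_rpow h1 hr.le
  rw [ENNReal.mul_rpow_of_nonneg _ _ hr.le, ← ENNReal.rpow_mul, ← ENNReal.rpow_mul,
    ← ENNReal.rpow_mul, one_div_mul_cancel hr.ne', ENNReal.rpow_one] at h2
  simpa only [one_div_mul_eq_div, Pi.mul_apply] using h2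

end Scalar

/-! ### Averages at dyadic scales -/

section Averages

section Uniform

variable {E : Type*} [NormedAddCommGroup E] [MeasurableSpace E] (μ : Measure E)

/-- The uniform probability measure on the ball of radius `2 ^ k` centred at the origin. -/
noncomputable def dyadicUniform (k : ℤ) : Measure E := μ[|ball (0 : E) (2 ^ k)]

lemma lintegral_dyadicUniform (h : E → ℝ≥0∞) (k : ℤ) :
    ∫⁻ y, h y ∂(dyadicUniform μ k) =
      (μ (ball (0 : E) (2 ^ k)))⁻¹ * ∫⁻ y in ball (0 : E) (2 ^ k), h y ∂μ := by
  rw [dyadicUniform, ProbabilityTheory.cond, lintegral_smul_measure, smul_eq_mul]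

end Uniform

variable {E : Type*} [NormedAddCommGroup E] [NormedSpace ℝ E] [FiniteDimensional ℝ E]
  [MeasurableSpace E] [BorelSpace E] (μ : Measure E) [μ.IsAddHaarMeasure]

/-- The average of `f` over the ball of radius `2 ^ k` centred at `x`. -/
noncomputable def ballAvg (f : E → ℝ≥0∞) (k : ℤ) (x : E) : ℝ≥0∞ :=
  ∫⁻ y, f (x + y) ∂(dyadicUniform μ k)

/-- The bilinear average of `f` and `g` at scale `2 ^ k`: the part of the bilinear fractional
integral coming from `‖y‖ < 2 ^ k`, with the kernel replaced by the normalised indicator function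
of that ball. -/
noncomputable def bilinAvg (θ : ℝ) (f g : E → ℝ≥0∞) (k : ℤ) (x : E) : ℝ≥0∞ :=
  ∫⁻ y, f (x + (θ - 1) • y) * g (x + θ • y) ∂(dyadicUniform μ k)

lemma measure_dyadicBall (k : ℤ) :
    μ (ball (0 : E) (2 ^ k)) = 2 ^ ((k : ℝ) * finrank ℝ E) * μ (ball (0 : E) 1) := by
  rw [Measure.addHaar_ball_of_pos μ 0 (by positivity), ENNReal.ofReal_pow (by positivity),
    ← Real.rpow_intCast, ← ENNReal.ofReal_rpow_of_pos two_pos, ENNReal.rpow_mul,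
    ENNReal.rpow_natCast, ENNReal.ofReal_ofNat]

instance (k : ℤ) : IsProbabilityMeasure (dyadicUniform μ k) :=
  cond_isProbabilityMeasure_of_finite (measure_ball_pos μ 0 (by positivity)).ne'
    measure_ball_lt_top.ne

variable {f g : E → ℝ≥0∞}

lemma measurable_ballAvg (hf : Measurable f) (k : ℤ) : Measurable (ballAvg μ f k) :=
  Measurable.lintegral_prod_right' (f := fun z : E × E => f (z.1 + z.2)) (by fun_prop)

lemma measurable_bilinAvg (θ : ℝ) (hf : Measurable f) (hg : Measurable g) (k : ℤ) :
    Measurable (bilinAvg μ θ f g k) :=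
  Measurable.lintegral_prod_right'
    (f := fun z : E × E => f (z.1 + (θ - 1) • z.2) * g (z.1 + θ • z.2)) (by fun_prop)

lemma lintegral_ballAvg (hf : Measurable f) (k : ℤ) :
    ∫⁻ x, ballAvg μ f k x ∂μ = ∫⁻ x, f x ∂μ := by
  unfold ballAvg
  rw [lintegral_lintegral_swap (by fun_prop)]
  simp_rw [lintegral_add_right_eq_self]
  simp

lemma ballAvg_le (hf : Measurable f) {p : ℝ} (hp : 1 ≤ p) (k : ℤ) (x : E) :
    ballAvg μ f k x ≤ μ (ball (0 : E) (2 ^ k)) ^ (-(1 / p)) * (∫⁻ y, f y ^ p ∂μ) ^ (1 / p) := by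
  have hp0 : 0 < p := by linarith
  have h : ballAvg μ f k x ^ p ≤ (μ (ball (0 : E) (2 ^ k)))⁻¹ * ∫⁻ y, f y ^ p ∂μ := by
    calc ballAvg μ f k x ^ p ≤ ∫⁻ y, f (x + y) ^ p ∂(dyadicUniform μ k) :=
          rpow_lintegral_le_lintegral_rpow (by fun_prop) hp
      _ ≤ (μ (ball (0 : E) (2 ^ k)))⁻¹ * ∫⁻ y, f (x + y) ^ p ∂μ := by
          rw [lintegral_dyadicUniform]
          gcongr
          exact Measure.restrict_le_self
      _ = _ := by rw [lintegral_add_left_eq_self (fun y => f y ^ p)]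
  rw [ENNReal.rpow_neg, ← ENNReal.inv_rpow, ← ENNReal.mul_rpow_of_nonneg _ _ (by positivity),
    one_div]
  exact (ENNReal.le_rpow_inv_iff hp0).2 h

lemma bilinAvg_rpow_le {θ t : ℝ} (hf : Measurable f) (hg : Measurable g) (ht : 1 ≤ t) (k : ℤ)
    (x : E) :
    bilinAvg μ θ f g k x ^ t ≤ bilinAvg μ θ (fun y => f y ^ t) (fun y => g y ^ t) k x := by
  refine (rpow_lintegral_le_lintegral_rpow (by fun_prop) ht).trans_eq ?_
  simp_rw [ENNReal.mul_rpow_of_nonneg _ _ (by linarith : 0 ≤ t)]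
  rfl

lemma lintegral_lintegral_shear (θ : ℝ) (hf : Measurable f) (hg : Measurable g) :
    ∫⁻ x, ∫⁻ y, f (x + (θ - 1) • y) * g (x + θ • y) ∂μ ∂μ =
      (∫⁻ x, f x ∂μ) * ∫⁻ x, g x ∂μ := by
  rw [lintegral_lintegral_swap (by fun_prop)]
  have h : ∀ y, ∫⁻ x, f (x + (θ - 1) • y) * g (x + θ • y) ∂μ = ∫⁻ x, f x * g (x + y) ∂μ := by
    intro y
    rw [← lintegral_add_right_eq_self (fun x => f x * g (x + y)) ((θ - 1) • y)]
    refine lintegral_congr fun x => ?_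
    congr 2
    rw [add_assoc, sub_smul, one_smul, sub_add_cancel]
  simp_rw [h]
  rw [lintegral_lintegral_swap (by fun_prop), ← lintegral_mul_const _ hf]
  refine lintegral_congr fun x => ?_
  rw [lintegral_const_mul _ (by fun_prop), lintegral_add_left_eq_self]

lemma measure_dyadicBall_succ (k : ℤ) :
    μ (ball (0 : E) (2 ^ (k + 1))) = 2 ^ (finrank ℝ E : ℝ) * μ (ball (0 : E) (2 ^ k)) := by
  rw [measure_dyadicBall, measure_dyadicBall, ← mul_assoc, ← two_rpow_add]
  push_cast
  ring_nf

/-- After one more averaging the parameter `θ` disappears: the bilinear average is dominated by the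
product of two linear averages. -/
lemma ballAvg_bilinAvg_le {θ : ℝ} (hθ : θ ∈ Set.Icc (0 : ℝ) 1) (hf : Measurable f)
    (hg : Measurable g) (k : ℤ) (x : E) :
    ballAvg μ (bilinAvg μ θ f g k) k x ≤
      (2 ^ (finrank ℝ E : ℝ)) ^ 2 * (ballAvg μ f (k + 1) x * ballAvg μ g (k + 1) x) := by
  set B := ball (0 : E) (2 ^ k)
  set B' := ball (0 : E) (2 ^ (k + 1)) with hB'
  have hBm : MeasurableSet B := measurableSet_ball
  have hBm' : MeasurableSet B' := measurableSet_ball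
  set F := B'.indicator fun v => f (x + v) with hF
  set G := B'.indicator fun v => g (x + v) with hG
  have hFm : Measurable F := (by fun_prop : Measurable fun v => f (x + v)).indicator hBm'
  have hGm : Measurable G := (by fun_prop : Measurable fun v => g (x + v)).indicator hBm'
  have hmem : ∀ {u v : E} {c : ℝ}, u ∈ B → v ∈ B → |c| ≤ 1 → u + c • v ∈ B' := by
    intro u v c hu hv hc
    rw [hB', mem_ball_zero_iff, zpow_add_one₀ two_ne_zero]
    have h1 := mem_ball_zero_iff.1 hu
    have h2 := mem_ball_zero_iff.1 hv
    calc ‖u + c • v‖ ≤ ‖u‖ + |c| * ‖v‖ := by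
          simpa [norm_smul] using norm_add_le u (c • v)
      _ ≤ ‖u‖ + 1 * ‖v‖ := by gcongr
      _ < _ := by linarith
  have h1 : ∫⁻ u in B, ∫⁻ v in B, f (x + u + (θ - 1) • v) * g (x + u + θ • v) ∂μ ∂μ ≤
      (∫⁻ v in B', f (x + v) ∂μ) * ∫⁻ v in B', g (x + v) ∂μ := by
    calc _ ≤ ∫⁻ u in B, ∫⁻ v in B, F (u + (θ - 1) • v) * G (u + θ • v) ∂μ ∂μ := by
          refine setLIntegral_mono' hBm fun u hu => setLIntegral_mono' hBm fun v hv => ?_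
          rw [hF, hG, Set.indicator_of_mem (hmem hu hv (abs_le.2 ⟨by linarith [hθ.1], by
              linarith [hθ.2]⟩)), Set.indicator_of_mem (hmem hu hv (abs_le.2 ⟨by linarith [hθ.1],
              by linarith [hθ.2]⟩)), add_assoc, add_assoc]
      _ ≤ ∫⁻ u, ∫⁻ v, F (u + (θ - 1) • v) * G (u + θ • v) ∂μ ∂μ :=
          lintegral_mono' Measure.restrict_le_self fun u =>
            lintegral_mono' Measure.restrict_le_self fun v => le_rfl
      _ = _ := by
          rw [lintegral_lintegral_shear μ θ hFm hGm, lintegral_indicator hBm',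
            lintegral_indicator hBm']
  have hB0 : μ B ≠ 0 := (measure_ball_pos μ 0 (by positivity)).ne'
  have hBt : μ B ≠ ∞ := measure_ball_lt_top.ne
  have h2 : (2 : ℝ≥0∞) ^ (finrank ℝ E : ℝ) * (μ B')⁻¹ = (μ B)⁻¹ := by
    rw [measure_dyadicBall_succ, ENNReal.mul_inv (Or.inr hBt) (Or.inr hB0), ← mul_assoc,
      ENNReal.mul_inv_cancel (two_rpow_ne_zero _) (two_rpow_ne_top _), one_mul]
  unfold ballAvg bilinAvg
  simp_rw [lintegral_dyadicUniform]
  rw [lintegral_const_mul' _ _ (ENNReal.inv_ne_top.2 hB0)]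
  calc _ ≤ (μ B)⁻¹ * ((μ B)⁻¹ * ((∫⁻ v in B', f (x + v) ∂μ) * ∫⁻ v in B', g (x + v) ∂μ)) := by
        gcongr
    _ = _ := by rw [← h2]; ring

/-- The localization step: for `s ≤ 1` the `L^s` size of the bilinear average is controlled by
linear averages at the same scale, uniformly in `θ`. -/
lemma lintegral_bilinAvg_rpow_le {θ s : ℝ} (hθ : θ ∈ Set.Icc (0 : ℝ) 1) (hs : 0 < s)
    (hs1 : s ≤ 1) (hf : Measurable f) (hg : Measurable g) (k : ℤ) :
    ∫⁻ x, bilinAvg μ θ f g k x ^ s ∂μ ≤ ((2 ^ (finrank ℝ E : ℝ)) ^ 2) ^ s *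
      ∫⁻ x, (ballAvg μ f (k + 1) x * ballAvg μ g (k + 1) x) ^ s ∂μ := by
  have hm := measurable_bilinAvg μ θ hf hg k
  rw [← lintegral_ballAvg μ (hm.pow_const s) k, ← lintegral_const_mul' _ _ (by
    exact ENNReal.rpow_ne_top_of_nonneg hs.le (ENNReal.pow_ne_top (two_rpow_ne_top _)))]
  refine lintegral_mono fun x => ?_
  rw [← ENNReal.mul_rpow_of_nonneg _ _ hs.le]
  exact (lintegral_rpow_le_rpow_lintegral (by fun_prop) hs hs1).trans
    (ENNReal.rpow_le_rpow (ballAvg_bilinAvg_le μ hθ hf hg k x) hs.le)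

end Averages

/-! ### Sums over all scales -/

/-- A self-improving form of the bound `u ^ s ≤ R ^ (s - 1) * u` for an average `u ≤ R` of `h`: at
least half of `u` comes from the points where `u ≤ 2 * h`, and there `u ≤ min (2 * h) R`. -/
lemma rpow_lintegral_le_lintegral_mul_min {Ω : Type*} [MeasurableSpace Ω] {ν : Measure Ω}
    [IsProbabilityMeasure ν] {h : Ω → ℝ≥0∞} (hh : Measurable h) {R : ℝ≥0∞} {s : ℝ} (hs : 1 < s)
    (hR : ∫⁻ x, h x ∂ν ≤ R) (hfin : ∫⁻ x, h x ∂ν ≠ ∞) :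
    (∫⁻ x, h x ∂ν) ^ s ≤ 2 * ∫⁻ x, h x * min (2 * h x) R ^ (s - 1) ∂ν := by
  set u := ∫⁻ x, h x ∂ν with hu
  have hs1 : 0 < s - 1 := by linarith
  set A : Set Ω := {x | u ≤ 2 * h x} with hA
  have hAm : MeasurableSet A := measurableSet_le measurable_const (by fun_prop)
  have h1 : u ≤ u / 2 + ∫⁻ x, A.indicator h x ∂ν := by
    calc u ≤ ∫⁻ x, (u / 2 + A.indicator h x) ∂ν := by
          rw [hu]
          refine lintegral_mono fun x => ?_
          by_cases hx : x ∈ A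
          · rw [Set.indicator_of_mem hx]; exact le_add_self
          · rw [Set.indicator_of_notMem hx, add_zero]
            have : 2 * h x < u := not_le.1 hx
            rw [ENNReal.le_div_iff_mul_le (by simp) (by simp), mul_comm]
            exact this.le
      _ = _ := by rw [lintegral_add_left measurable_const, lintegral_const]; simp
  have h2 : u / 2 ≤ ∫⁻ x, A.indicator h x ∂ν := by
    have hfin2 : u / 2 ≠ ∞ := ENNReal.div_ne_top hfin two_ne_zero
    rw [← ENNReal.add_le_add_iff_left hfin2, ENNReal.add_halves]
    exact h1
  have h3 : u ≤ 2 * ∫⁻ x, A.indicator h x ∂ν := by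
    rw [ENNReal.div_le_iff (by simp) (by simp)] at h2
    rwa [mul_comm]
  rcases eq_or_ne u 0 with h0 | h0
  · rw [h0, ENNReal.zero_rpow_of_pos (by linarith)]; exact zero_le
  calc u ^ s = u ^ (s - 1) * u := by
        nth_rw 3 [← ENNReal.rpow_one u]
        rw [← ENNReal.rpow_add _ _ h0 hfin]; ring_nf
    _ ≤ u ^ (s - 1) * (2 * ∫⁻ x, A.indicator h x ∂ν) := by gcongr
    _ = 2 * ∫⁻ x, u ^ (s - 1) * A.indicator h x ∂ν := by
        rw [lintegral_const_mul _ (hh.indicator hAm)]; ring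
    _ ≤ _ := by
        refine mul_le_mul_right (lintegral_mono fun x => ?_) 2
        by_cases hx : x ∈ A
        · rw [Set.indicator_of_mem hx, mul_comm]
          gcongr
          exact le_min hx hR
        · rw [Set.indicator_of_notMem hx, mul_zero]; exact zero_le

section FractionalAverages

variable {E : Type*} [NormedAddCommGroup E] [NormedSpace ℝ E] [FiniteDimensional ℝ E]
  [MeasurableSpace E] [BorelSpace E] (μ : Measure E) [μ.IsAddHaarMeasure]

/-- The map `f ↦ (2 ^ (k * a) * ballAvg μ f k)_k` is bounded from `L^p` to `ℓ^s (L^s)` for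
`1 < p < s` and `a = n * (1 / p - 1 / s)`. No maximal function is needed: by
`rpow_lintegral_le_lintegral_mul_min` the sum over `k` can be taken under the integral of `f`, where
it is a sum of minima of two geometric sequences. -/
lemma exists_tsum_lintegral_ballAvg_rpow_le (hn : 0 < finrank ℝ E) {p s : ℝ} (hp : 1 < p)
    (hps : p < s) :
    ∃ C : ℝ≥0∞, C ≠ ∞ ∧ ∀ f : E → ℝ≥0∞, Measurable f →
      ∑' k : ℤ, ∫⁻ x, (2 ^ (k * (finrank ℝ E * (1 / p - 1 / s))) * ballAvg μ f k x) ^ s ∂μ ≤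
        C * (∫⁻ x, f x ^ p ∂μ) ^ (s / p) := by
  set n : ℝ := (finrank ℝ E : ℝ) with hn'
  have hn0 : 0 < n := Nat.cast_pos.2 hn
  have hp0 : 0 < p := by linarith
  have hs0 : 0 < s := by linarith
  have hs1 : 0 < s - 1 := by linarith
  have hp1 : 0 < p - 1 := by linarith
  set W := μ (ball (0 : E) 1) with hW
  have hW0 : W ≠ 0 := (measure_ball_pos μ 0 one_pos).ne'
  have hWt : W ≠ ∞ := measure_ball_lt_top.ne
  set a : ℝ := n * (s - p) / p with ha
  set b : ℝ := n * (p - 1) / p with hb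
  have ha0 : 0 < a := div_pos (mul_pos hn0 (by linarith)) hp0
  have hb0 : 0 < b := div_pos (mul_pos hn0 hp1) hp0
  have hsum : a + b = n * (s - 1) / p := by rw [ha, hb]; field_simp; ring
  have hea : (s - 1) * (a / (a + b)) = s - p := by rw [hsum, ha]; field_simp
  have heb : (s - 1) * (b / (a + b)) = p - 1 := by rw [hsum, hb]; field_simp
  obtain ⟨C, hC, hG⟩ := exists_tsum_min_geometric_le ha0 hb0
  refine ⟨2 * (C * (2 ^ (p - 1) * (W ^ (-(1 / p))) ^ (s - p))) + 1, ?_, fun f hf => ?_⟩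
  · have : (W ^ (-(1 / p))) ^ (s - p) ≠ ∞ :=
      ENNReal.rpow_ne_top_of_nonneg (by linarith) (ENNReal.rpow_ne_top_of_ne_zero hW0 hWt)
    have := two_rpow_ne_top (p - 1)
    finiteness
  set N := ∫⁻ x, f x ^ p ∂μ with hN
  -- The summand `1` in the constant makes it nonzero, so that the right side is `∞` in this case.
  rcases eq_or_ne N ∞ with hNt | hNt
  · rw [hNt, ENNReal.top_rpow_of_pos (by positivity), ENNReal.mul_top (by simp)]
    exact le_top
  -- `R k` bounds every average of `f` at scale `2 ^ k`
  set Z := W ^ (-(1 / p)) * N ^ (1 / p) with hZ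
  have hZt : Z ≠ ∞ := ENNReal.mul_ne_top (ENNReal.rpow_ne_top_of_ne_zero hW0 hWt)
    (ENNReal.rpow_ne_top_of_nonneg (by positivity) hNt)
  set R : ℤ → ℝ≥0∞ := fun k => 2 ^ (-(k : ℝ) * (n / p)) * Z with hR
  have hRt : ∀ k, R k ≠ ∞ := fun k => ENNReal.mul_ne_top (two_rpow_ne_top _) hZt
  have hle : ∀ k x, ballAvg μ f k x ≤ R k := fun k x => by
    refine (ballAvg_le μ hf hp.le k x).trans_eq ?_
    rw [measure_dyadicBall, ENNReal.mul_rpow_of_ne_zero (two_rpow_ne_zero _) hW0,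
      ← ENNReal.rpow_mul, mul_assoc]
    simp only [hR, hZ]
    congr 2
    rw [← hn']; ring
  have hmm : ∀ k, Measurable fun x => f x * min (2 * f x) (R k) ^ (s - 1) := fun k => by fun_prop
  have hk : ∀ k : ℤ, ∫⁻ x, (2 ^ (k * (n * (1 / p - 1 / s))) * ballAvg μ f k x) ^ s ∂μ ≤
      ∫⁻ x, 2 * (f x * min ((2 * f x) ^ (s - 1) * 2 ^ (k * a))
        (Z ^ (s - 1) * 2 ^ (-(k : ℝ) * b))) ∂μ := fun k => by
    calc _ ≤ ∫⁻ x, 2 ^ (k * a) *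
          (2 * ballAvg μ (fun y => f y * min (2 * f y) (R k) ^ (s - 1)) k x) ∂μ := by
          refine lintegral_mono fun x => ?_
          rw [ENNReal.mul_rpow_of_nonneg _ _ hs0.le, ← ENNReal.rpow_mul]
          refine mul_le_mul' (le_of_eq ?_) ?_
          · congr 1; rw [ha]; field_simp
          · exact rpow_lintegral_le_lintegral_mul_min (by fun_prop) (by linarith) (hle k x)
              (ne_top_of_le_ne_top (hRt k) (hle k x))
      _ = 2 ^ (k * a) * (2 * ∫⁻ x, f x * min (2 * f x) (R k) ^ (s - 1) ∂μ) := by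
          rw [lintegral_const_mul' _ _ (two_rpow_ne_top _), lintegral_const_mul' _ _ (by simp),
            lintegral_ballAvg μ (hmm k)]
      _ = ∫⁻ x, 2 ^ (k * a) * (2 * (f x * min (2 * f x) (R k) ^ (s - 1))) ∂μ := by
          rw [lintegral_const_mul' _ _ (two_rpow_ne_top _), lintegral_const_mul' _ _ (by simp)]
      _ = _ := by
          refine lintegral_congr fun x => ?_
          have : Z ^ (s - 1) * 2 ^ (-(k : ℝ) * b) = 2 ^ (k * a) * R k ^ (s - 1) := by
            simp only [hR]
            rw [ENNReal.mul_rpow_of_nonneg (2 ^ (-(k : ℝ) * (n / p))) Z hs1.le, ← ENNReal.rpow_mul,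
              ← mul_assoc, ← two_rpow_add, mul_comm]
            congr 2
            rw [ha, hb]; field_simp; ring
          rw [this, (ENNReal.monotone_rpow_of_nonneg hs1.le).map_min,
            mul_comm ((2 * f x) ^ (s - 1)), min_mul_mul_left]
          ring
  calc _ ≤ ∑' k : ℤ, ∫⁻ x, 2 * (f x * min ((2 * f x) ^ (s - 1) * 2 ^ (k * a))
        (Z ^ (s - 1) * 2 ^ (-(k : ℝ) * b))) ∂μ := ENNReal.tsum_le_tsum hk
    _ = ∫⁻ x, 2 * (f x * ∑' k : ℤ, min ((2 * f x) ^ (s - 1) * 2 ^ (k * a))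
        (Z ^ (s - 1) * 2 ^ (-(k : ℝ) * b))) ∂μ := by
        rw [← lintegral_tsum fun k => by fun_prop]
        simp_rw [ENNReal.tsum_mul_left]
    _ ≤ ∫⁻ x, 2 * (C * (2 ^ (p - 1) * Z ^ (s - p))) * f x ^ p ∂μ := by
        refine lintegral_mono fun x => ?_
        calc _ ≤ 2 * (f x * (C * (((2 * f x) ^ (s - 1)) ^ (b / (a + b)) *
              (Z ^ (s - 1)) ^ (a / (a + b))))) := by gcongr; exact hG _ _
          _ = 2 * (C * (2 ^ (p - 1) * Z ^ (s - p))) * (f x * f x ^ (p - 1)) := by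
              rw [← ENNReal.rpow_mul, ← ENNReal.rpow_mul, hea, heb,
                ENNReal.mul_rpow_of_nonneg _ _ hp1.le]
              ring
          _ = _ := by
              congr 1
              nth_rw 1 [← ENNReal.rpow_one (f x)]
              rw [← ENNReal.rpow_add_of_nonneg _ _ zero_le_one hp1.le]
              ring_nf
    _ = 2 * (C * (2 ^ (p - 1) * (W ^ (-(1 / p))) ^ (s - p))) * N ^ (s / p) := by
        rw [lintegral_const_mul _ (hf.pow_const p), ← hN, hZ,
          ENNReal.mul_rpow_of_nonneg _ _ (by linarith), ← ENNReal.rpow_mul N]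
        have : N ^ (s / p) = N ^ (1 / p * (s - p)) * N := by
          nth_rw 3 [← ENNReal.rpow_one N]
          rw [← ENNReal.rpow_add_of_nonneg _ _ (mul_nonneg (by positivity) (by linarith))
            zero_le_one]
          congr 1; field_simp; ring
        rw [this]; ring
    _ ≤ _ := by gcongr; exact le_self_add

/-- The bilinear averages at all scales, summed in `ℓ^r (L^r)`, uniformly in `θ`. Jensen's
inequality with the power `t = max 1 r`, which is smaller than `p` and `q`, leads to an exponent
`r / t ≤ 1`, where localization and Hölder's inequality reduce it to linear averages. -/
lemma exists_tsum_lintegral_bilinAvg_rpow_le (hn : 0 < finrank ℝ E) {α p q r : ℝ} (hα : 0 < α)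
    (hp : 1 < p) (hq : 1 < q) (hr : 0 < r) (hαp : α / finrank ℝ E < 1 / p)
    (hαq : α / finrank ℝ E < 1 / q) (h : 1 / r = 1 / p + 1 / q - α / finrank ℝ E) :
    ∃ C : ℝ≥0∞, C ≠ ∞ ∧ ∀ θ ∈ Set.Icc (0 : ℝ) 1, ∀ f g : E → ℝ≥0∞, Measurable f → Measurable g →
      ∑' k : ℤ, ∫⁻ x, (2 ^ (k * α) * bilinAvg μ θ f g k x) ^ r ∂μ ≤
        C * ((∫⁻ x, f x ^ p ∂μ) ^ (r / p) * (∫⁻ x, g x ^ q ∂μ) ^ (r / q)) := by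
  set n : ℝ := (finrank ℝ E : ℝ) with hn'
  have hn0 : 0 < n := Nat.cast_pos.2 hn
  have hp0 : 0 < p := by linarith
  have hq0 : 0 < q := by linarith
  set t := max 1 r with ht
  have ht1 : 1 ≤ t := le_max_left _ _
  have ht0 : 0 < t := by linarith
  have htp : t < p := max_lt hp ((one_div_lt_one_div hp0 hr).1 (by linarith))
  have htq : t < q := max_lt hq ((one_div_lt_one_div hq0 hr).1 (by linarith))
  have hρ0 : 0 < r / t := by positivity
  have hρ1 : r / t ≤ 1 := (div_le_one ht0).2 (le_max_right _ _)
  have hαn : 0 < α / n := by positivity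
  -- half of the smoothing `α` is spent on each of the two functions
  have key : ∀ {p : ℝ}, 0 < p → α / n < 1 / p → ∃ s, 0 < s ∧ p / t < s ∧
      1 / s = t / p - α * t / (2 * n) := by
    intro p hp0 hαp
    have h1 : 0 < t / p - α * t / (2 * n) := by
      have h2 : t / p - α * t / (2 * n) = t * ((1 / p - α / n) + α / n / 2) := by
        field_simp; ring
      rw [h2]
      exact mul_pos ht0 (by linarith)
    refine ⟨1 / (t / p - α * t / (2 * n)), by positivity, ?_, by rw [one_div_one_div]⟩
    rw [lt_one_div (by positivity) h1, one_div_div]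
    have : 0 < α * t / (2 * n) := by positivity
    linarith
  obtain ⟨s, hs0, hps, hs⟩ := key hp0 hαp
  obtain ⟨u, hu0, hqu, hu⟩ := key hq0 hαq
  obtain ⟨C₁, hC₁, h₁⟩ := exists_tsum_lintegral_ballAvg_rpow_le μ hn ((one_lt_div ht0).2 htp) hps
  obtain ⟨C₂, hC₂, h₂⟩ := exists_tsum_lintegral_ballAvg_rpow_le μ hn ((one_lt_div ht0).2 htq) hqu
  have hea : n * (1 / (p / t) - 1 / s) = α * t / 2 := by rw [hs, one_div_div]; field_simp; ring
  have heb : n * (1 / (q / t) - 1 / u) = α * t / 2 := by rw [hu, one_div_div]; field_simp; ring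
  rw [← hn', hea] at h₁
  rw [← hn', heb] at h₂
  have hsu : 1 / (r / t) = 1 / s + 1 / u := by
    rw [hs, hu, one_div_div, div_eq_mul_one_div t r, h]; field_simp; ring
  set K : ℝ≥0∞ := ((2 ^ n) ^ 2) ^ (r / t) * 2 ^ (-(α * r)) with hK
  have hKt : K ≠ ∞ := ENNReal.mul_ne_top
    (ENNReal.rpow_ne_top_of_nonneg hρ0.le (ENNReal.pow_ne_top (two_rpow_ne_top _)))
    (two_rpow_ne_top _)
  refine ⟨K * (C₁ ^ (r / t / s) * C₂ ^ (r / t / u)), ?_, fun θ hθ f g hf hg => ?_⟩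
  · have := ENNReal.rpow_ne_top_of_nonneg (div_pos hρ0 hs0).le hC₁
    have := ENNReal.rpow_ne_top_of_nonneg (div_pos hρ0 hu0).le hC₂
    finiteness
  set F : E → ℝ≥0∞ := fun x => f x ^ t with hF
  set G : E → ℝ≥0∞ := fun x => g x ^ t with hG
  have hFm : Measurable F := hf.pow_const t
  have hGm : Measurable G := hg.pow_const t
  set Φ : ℤ → E → ℝ≥0∞ := fun k x => 2 ^ (k * (α * t / 2)) * ballAvg μ F k x with hΦ
  set Ψ : ℤ → E → ℝ≥0∞ := fun k x => 2 ^ (k * (α * t / 2)) * ballAvg μ G k x with hΨ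
  have hΦm : ∀ k, Measurable (Φ k) := fun k => (measurable_ballAvg μ hFm k).const_mul _
  have hΨm : ∀ k, Measurable (Ψ k) := fun k => (measurable_ballAvg μ hGm k).const_mul _
  have hk : ∀ k : ℤ, ∫⁻ x, (2 ^ (k * α) * bilinAvg μ θ f g k x) ^ r ∂μ ≤
      K * ∫⁻ x, (Φ (k + 1) x * Ψ (k + 1) x) ^ (r / t) ∂μ := fun k => by
    calc _ ≤ ∫⁻ x, 2 ^ (k * α * r) * bilinAvg μ θ F G k x ^ (r / t) ∂μ := by
          refine lintegral_mono fun x => ?_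
          rw [ENNReal.mul_rpow_of_nonneg _ _ hr.le, ← ENNReal.rpow_mul]
          gcongr
          calc bilinAvg μ θ f g k x ^ r = (bilinAvg μ θ f g k x ^ t) ^ (r / t) := by
                rw [← ENNReal.rpow_mul]; congr 1; field_simp
            _ ≤ _ := ENNReal.rpow_le_rpow (bilinAvg_rpow_le μ hf hg ht1 k x) hρ0.le
      _ ≤ 2 ^ (k * α * r) * (((2 ^ n) ^ 2) ^ (r / t) *
          ∫⁻ x, (ballAvg μ F (k + 1) x * ballAvg μ G (k + 1) x) ^ (r / t) ∂μ) := by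
          rw [lintegral_const_mul' _ _ (two_rpow_ne_top _)]
          gcongr
          exact lintegral_bilinAvg_rpow_le μ hθ hρ0 hρ1 hFm hGm k
      _ = _ := by
          have : ∀ x, (Φ (k + 1) x * Ψ (k + 1) x) ^ (r / t) = 2 ^ ((k + 1) * α * r) *
              (ballAvg μ F (k + 1) x * ballAvg μ G (k + 1) x) ^ (r / t) := fun x => by
            simp only [hΦ, hΨ]
            rw [mul_mul_mul_comm, ENNReal.mul_rpow_of_nonneg _ _ hρ0.le, ← two_rpow_add,
              ← ENNReal.rpow_mul]
            congr 2
            push_cast; field_simp; ring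
          simp_rw [this]
          rw [lintegral_const_mul' _ _ (two_rpow_ne_top _), hK]
          have : (2 : ℝ≥0∞) ^ (k * α * r) = 2 ^ (-(α * r)) * 2 ^ ((k + 1) * α * r) := by
            rw [← two_rpow_add]; ring_nf
          rw [this]; ring
  have hpow : ∀ (v : E → ℝ≥0∞) (e : ℝ), ∫⁻ x, (v x ^ t) ^ (e / t) ∂μ = ∫⁻ x, v x ^ e ∂μ :=
    fun v e => by
      refine lintegral_congr fun x => ?_
      rw [← ENNReal.rpow_mul]; congr 1; field_simp
  calc _ ≤ ∑' k : ℤ, K * ∫⁻ x, (Φ (k + 1) x * Ψ (k + 1) x) ^ (r / t) ∂μ :=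
        ENNReal.tsum_le_tsum hk
    _ = K * ∑' k : ℤ, ∫⁻ x, (Φ k x * Ψ k x) ^ (r / t) ∂μ := by
        rw [ENNReal.tsum_mul_left,
          ← (Equiv.addRight (1 : ℤ)).tsum_eq fun k => ∫⁻ x, (Φ k x * Ψ k x) ^ (r / t) ∂μ]
        rfl
    _ ≤ K * ((∑' k, ∫⁻ x, Φ k x ^ s ∂μ) ^ (r / t / s) *
          (∑' k, ∫⁻ x, Ψ k x ^ u ∂μ) ^ (r / t / u)) := by
        gcongr
        exact tsum_lintegral_mul_rpow_le hρ0 hs0 hu0 hsu hΦm hΨm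
    _ ≤ K * ((C₁ * (∫⁻ x, F x ^ (p / t) ∂μ) ^ (s / (p / t))) ^ (r / t / s) *
          (C₂ * (∫⁻ x, G x ^ (q / t) ∂μ) ^ (u / (q / t))) ^ (r / t / u)) := by
        gcongr
        · exact h₁ F hFm
        · exact h₂ G hGm
    _ = _ := by
        rw [ENNReal.mul_rpow_of_nonneg _ _ (by positivity),
          ENNReal.mul_rpow_of_nonneg _ _ (by positivity), ← ENNReal.rpow_mul, ← ENNReal.rpow_mul,
          hpow f, hpow g]
        have e1 : s / (p / t) * (r / t / s) = r / p := by field_simp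
        have e2 : u / (q / t) * (r / t / u) = r / q := by field_simp
        rw [e1, e2]; ring

end FractionalAverages

/-! ### The bilinear integral of measurable functions -/

section BilinearIntegral

variable {E : Type*} [NormedAddCommGroup E] [NormedSpace ℝ E] [FiniteDimensional ℝ E]
  [MeasurableSpace E] [BorelSpace E] (μ : Measure E) [μ.IsAddHaarMeasure]

/-- The kernel is dominated by a sum of normalised indicator functions of dyadic balls; at `y` only
the smallest dyadic ball containing `y` is needed. -/
lemma enorm_rpow_le_tsum_indicator {α : ℝ} (hα : α ≤ finrank ℝ E) {y : E} (hy : y ≠ 0) :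
    ‖y‖ₑ ^ (α - finrank ℝ E) ≤ ∑' k : ℤ, (ball (0 : E) (2 ^ k)).indicator
      (fun _ => 2 ^ (finrank ℝ E - α) * μ (ball (0 : E) 1) *
        (2 ^ (k * α) * (μ (ball (0 : E) (2 ^ k)))⁻¹)) y := by
  obtain ⟨m, hm1, hm2⟩ := exists_mem_Ico_zpow (norm_pos_iff.2 hy) (one_lt_two (α := ℝ))
  have hmem : y ∈ ball (0 : E) (2 ^ (m + 1)) := mem_ball_zero_iff.2 hm2
  refine le_trans ?_ (ENNReal.le_tsum (m + 1))
  rw [Set.indicator_of_mem hmem, measure_dyadicBall]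
  set n : ℝ := (finrank ℝ E : ℝ)
  have hW0 : μ (ball (0 : E) 1) ≠ 0 := (measure_ball_pos μ 0 one_pos).ne'
  have hWt : μ (ball (0 : E) 1) ≠ ∞ := measure_ball_lt_top.ne
  have h2m : (2 : ℝ≥0∞) ^ (m : ℝ) ≤ ‖y‖ₑ := by
    rw [← ofReal_norm, ← ENNReal.ofReal_ofNat 2, ENNReal.ofReal_rpow_of_pos two_pos,
      Real.rpow_intCast]
    exact ENNReal.ofReal_le_ofReal hm1
  calc ‖y‖ₑ ^ (α - n) ≤ (2 ^ (m : ℝ)) ^ (α - n) := by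
        rw [← neg_sub, ENNReal.rpow_neg, ENNReal.rpow_neg]
        exact ENNReal.inv_le_inv.2 (ENNReal.rpow_le_rpow h2m (by linarith))
    _ = 2 ^ (n - α) * (2 ^ (((m + 1 : ℤ) : ℝ) * α) * (2 ^ (((m + 1 : ℤ) : ℝ) * n))⁻¹) := by
        rw [← ENNReal.rpow_mul, ← ENNReal.rpow_neg, ← two_rpow_add, ← two_rpow_add]
        push_cast; ring_nf
    _ = 2 ^ (n - α) * (μ (ball (0 : E) 1) * (μ (ball (0 : E) 1))⁻¹) *
          (2 ^ (((m + 1 : ℤ) : ℝ) * α) * (2 ^ (((m + 1 : ℤ) : ℝ) * n))⁻¹) := by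
        rw [ENNReal.mul_inv_cancel hW0 hWt, mul_one]
    _ = _ := by
        rw [ENNReal.mul_inv (Or.inr hWt) (Or.inr hW0)]; ring

lemma lintegral_mul_enorm_rpow_le_tsum_bilinAvg [Nontrivial E] {α : ℝ} (hα : α ≤ finrank ℝ E)
    (θ : ℝ) {f g : E → ℝ≥0∞} (hf : Measurable f) (hg : Measurable g) (x : E) :
    ∫⁻ y, f (x + (θ - 1) • y) * g (x + θ • y) * ‖y‖ₑ ^ (α - finrank ℝ E) ∂μ ≤
      2 ^ (finrank ℝ E - α) * μ (ball (0 : E) 1) *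
        ∑' k : ℤ, 2 ^ (k * α) * bilinAvg μ θ f g k x := by
  set c : ℝ≥0∞ := 2 ^ (finrank ℝ E - α) * μ (ball (0 : E) 1)
  set h : E → ℝ≥0∞ := fun y => f (x + (θ - 1) • y) * g (x + θ • y) with hh
  have hm : Measurable h := by fun_prop
  have hy : ∀ᵐ y ∂μ, y ≠ 0 := Measure.ae_ne μ 0
  calc ∫⁻ y, h y * ‖y‖ₑ ^ (α - finrank ℝ E) ∂μ
      ≤ ∫⁻ y, ∑' k : ℤ, (ball (0 : E) (2 ^ k)).indicator
          (fun z => c * (2 ^ (k * α) * (μ (ball (0 : E) (2 ^ k)))⁻¹) * h z) y ∂μ := by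
        refine lintegral_mono_ae (hy.mono fun y hy => ?_)
        calc h y * ‖y‖ₑ ^ (α - finrank ℝ E) ≤ h y * _ :=
              mul_le_mul_right (enorm_rpow_le_tsum_indicator μ hα hy) _
          _ = _ := by
              rw [← ENNReal.tsum_mul_left]
              refine tsum_congr fun k => ?_
              by_cases hk : y ∈ ball (0 : E) (2 ^ k)
              · simp only [Set.indicator_of_mem hk]; ring
              · simp only [Set.indicator_of_notMem hk, mul_zero]
    _ = _ := by
        rw [lintegral_tsum fun k => ((hm.const_mul _).indicator measurableSet_ball).aemeasurable,
          ← ENNReal.tsum_mul_left]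
        refine tsum_congr fun k => ?_
        rw [lintegral_indicator measurableSet_ball, lintegral_const_mul _ hm, bilinAvg,
          lintegral_dyadicUniform]
        ring

/-- The sum over all scales at smoothness `α` is controlled by the geometric mean of an `ℓ^s` norm
at smoothness `α - ε` and an `ℓ^u` norm at smoothness `α + ε`. In contrast to the triangle
inequality in `L^r`, this is available for all exponents, and it allows different exponents for the
two sums. -/
lemma exists_tsum_le_rpow_mul_rpow {ε : ℝ} (hε : 0 < ε) :
    ∃ C : ℝ≥0∞, C ≠ ∞ ∧ ∀ (α s u : ℝ) (A : ℤ → ℝ≥0∞), 0 < s → 0 < u →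
      ∑' k : ℤ, 2 ^ (k * α) * A k ≤
        C * ((∑' k : ℤ, (2 ^ (k * (α - ε)) * A k) ^ s) ^ (1 / (2 * s)) *
          (∑' k : ℤ, (2 ^ (k * (α + ε)) * A k) ^ u) ^ (1 / (2 * u))) := by
  obtain ⟨C, hC, h⟩ := exists_tsum_min_geometric_le hε hε
  refine ⟨C, hC, fun α s u A hs hu => ?_⟩
  have hsup : ∀ {s : ℝ} (_ : 0 < s) (b : ℤ → ℝ≥0∞) (k : ℤ), b k ≤ (∑' j, b j ^ s) ^ (1 / s) :=
    fun hs b k => by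
      rw [one_div, ENNReal.le_rpow_inv_iff hs]
      exact ENNReal.le_tsum (f := fun j => b j ^ _) k
  have hexp : ∀ {s : ℝ} (_ : 0 < s), 1 / s * (ε / (ε + ε)) = 1 / (2 * s) := fun hs => by
    field_simp; ring
  refine le_trans (ENNReal.tsum_le_tsum fun k => le_min ?_ ?_) ((h
    ((∑' k : ℤ, (2 ^ (k * (α - ε)) * A k) ^ s) ^ (1 / s))
    ((∑' k : ℤ, (2 ^ (k * (α + ε)) * A k) ^ u) ^ (1 / u))).trans_eq ?_)
  · calc 2 ^ (k * α) * A k = (2 ^ (k * (α - ε)) * A k) * 2 ^ (k * ε) := by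
          rw [mul_right_comm, ← two_rpow_add]; ring_nf
      _ ≤ _ := by gcongr; exact hsup hs (fun k => 2 ^ (k * (α - ε)) * A k) k
  · calc 2 ^ (k * α) * A k = (2 ^ (k * (α + ε)) * A k) * 2 ^ (-k * ε) := by
          rw [mul_right_comm, ← two_rpow_add]; ring_nf
      _ ≤ _ := by gcongr; exact hsup hu (fun k => 2 ^ (k * (α + ε)) * A k) k
  · rw [← ENNReal.rpow_mul, ← ENNReal.rpow_mul, hexp hs, hexp hu]

/-- The bound for the bilinear fractional integral of nonnegative measurable functions, in terms of
integrals of powers. -/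
lemma exists_lintegral_bilinFracInt_rpow_le [Nontrivial E] {α p q r : ℝ} (hα : 0 < α)
    (hαn : α < finrank ℝ E) (hp : 1 < p) (hq : 1 < q) (hαp : α / finrank ℝ E < 1 / p)
    (hαq : α / finrank ℝ E < 1 / q) (hr : 0 < r) (h : 1 / r = 1 / p + 1 / q - α / finrank ℝ E) :
    ∃ C : ℝ≥0∞, C ≠ ∞ ∧ ∀ θ ∈ Set.Icc (0 : ℝ) 1, ∀ f g : E → ℝ≥0∞, Measurable f → Measurable g →
      ∫⁻ x, (∫⁻ y, f (x + (θ - 1) • y) * g (x + θ • y) * ‖y‖ₑ ^ (α - finrank ℝ E) ∂μ) ^ r ∂μ ≤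
        C * ((∫⁻ x, f x ^ p ∂μ) ^ (r / p) * (∫⁻ x, g x ^ q ∂μ) ^ (r / q)) := by
  have hn : 0 < finrank ℝ E := finrank_pos
  set n : ℝ := (finrank ℝ E : ℝ) with hn'
  have hn0 : 0 < n := Nat.cast_pos.2 hn
  -- room for perturbing `α` to `α ± ε` while all hypotheses on the exponents persist
  obtain ⟨ε, hε, hεα, hεp, hεq⟩ : ∃ ε, 0 < ε ∧ 0 < α - ε ∧ (α + ε) / n < 1 / p ∧
      (α + ε) / n < 1 / q := by
    rw [div_lt_iff₀ hn0] at hαp hαq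
    obtain ⟨ε, hε, h1⟩ := exists_between
      (lt_min hα (lt_min (sub_pos.2 hαp) (sub_pos.2 hαq)))
    simp only [lt_min_iff] at h1
    exact ⟨ε, hε, by linarith, by rw [div_lt_iff₀ hn0]; linarith,
      by rw [div_lt_iff₀ hn0]; linarith⟩
  have hp0 : 0 < p := by linarith
  have hq0 : 0 < q := by linarith
  have hεn : (α - ε) / n < (α + ε) / n := by gcongr; linarith
  have hp' : 0 < 1 / p := by positivity
  have hq' : 0 < 1 / q := by positivity
  have hs0 : 0 < 1 / p + 1 / q - (α - ε) / n := by linarith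
  have hu0 : 0 < 1 / p + 1 / q - (α + ε) / n := by linarith
  obtain ⟨s, hs, hss⟩ : ∃ s, 0 < s ∧ 1 / s = 1 / p + 1 / q - (α - ε) / n :=
    ⟨_, one_div_pos.2 hs0, one_div_one_div _⟩
  obtain ⟨u, hu, huu⟩ : ∃ u, 0 < u ∧ 1 / u = 1 / p + 1 / q - (α + ε) / n :=
    ⟨_, one_div_pos.2 hu0, one_div_one_div _⟩
  have hrsu : 1 / r = 1 / (2 * s) + 1 / (2 * u) := by
    have e : 1 / (2 * s) + 1 / (2 * u) = (1 / s + 1 / u) / 2 := by field_simp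
    rw [e, hss, huu, h]; ring
  have hrs : r < 2 * s := by
    have : 0 < 1 / (2 * u) := by positivity
    exact (one_div_lt_one_div (by positivity) hr).1 (by linarith)
  obtain ⟨C₁, hC₁, h₁⟩ := exists_tsum_lintegral_bilinAvg_rpow_le μ hn hεα hp hq hs
    (hεn.trans hεp) (hεn.trans hεq) hss
  obtain ⟨C₂, hC₂, h₂⟩ := exists_tsum_lintegral_bilinAvg_rpow_le μ hn
    (by linarith : 0 < α + ε) hp hq hu hεp hεq huu
  obtain ⟨C₀, hC₀, h₀⟩ := exists_tsum_le_rpow_mul_rpow hε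
  set c : ℝ≥0∞ := 2 ^ (n - α) * μ (ball (0 : E) 1) * C₀ with hc
  have hct : c ≠ ∞ := ENNReal.mul_ne_top (ENNReal.mul_ne_top (two_rpow_ne_top _)
    measure_ball_lt_top.ne) hC₀
  refine ⟨c ^ r * (C₁ ^ (r / (2 * s)) * C₂ ^ (r / (2 * u))), ?_, fun θ hθ f g hf hg => ?_⟩
  · have := ENNReal.rpow_ne_top_of_nonneg hr.le hct
    have := ENNReal.rpow_ne_top_of_nonneg (by positivity : 0 ≤ r / (2 * s)) hC₁
    have := ENNReal.rpow_ne_top_of_nonneg (by positivity : 0 ≤ r / (2 * u)) hC₂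
    finiteness
  have hAm := measurable_bilinAvg μ θ hf hg
  set S : E → ℝ≥0∞ := fun x => ∑' k : ℤ, (2 ^ (k * (α - ε)) * bilinAvg μ θ f g k x) ^ s with hS
  set U : E → ℝ≥0∞ := fun x => ∑' k : ℤ, (2 ^ (k * (α + ε)) * bilinAvg μ θ f g k x) ^ u with hU
  have hSm : Measurable S := Measurable.tsum fun k => ((hAm k).const_mul _).pow_const _
  have hUm : Measurable U := Measurable.tsum fun k => ((hAm k).const_mul _).pow_const _
  have hSle := h₁ θ hθ f g hf hg
  rw [← lintegral_tsum fun k => (((hAm k).const_mul _).pow_const _).aemeasurable] at hSle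
  have hUle := h₂ θ hθ f g hf hg
  rw [← lintegral_tsum fun k => (((hAm k).const_mul _).pow_const _).aemeasurable] at hUle
  have hpt : ∀ x, ∫⁻ y, f (x + (θ - 1) • y) * g (x + θ • y) * ‖y‖ₑ ^ (α - n) ∂μ ≤
      c * (S x ^ (1 / (2 * s)) * U x ^ (1 / (2 * u))) := fun x => by
    refine (lintegral_mul_enorm_rpow_le_tsum_bilinAvg μ hαn.le θ hf hg x).trans ?_
    rw [hc, mul_assoc _ C₀]
    gcongr
    exact h₀ α s u (fun k => bilinAvg μ θ f g k x) hs hu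
  have hH := ENNReal.rpow_le_rpow (ENNReal.lintegral_Lp_mul_le_Lq_mul_Lr hr hrs hrsu μ
    (hSm.pow_const (1 / (2 * s))).aemeasurable (hUm.pow_const (1 / (2 * u))).aemeasurable) hr.le
  simp only [Pi.mul_apply] at hH
  rw [ENNReal.mul_rpow_of_nonneg _ _ hr.le, ← ENNReal.rpow_mul, ← ENNReal.rpow_mul,
    ← ENNReal.rpow_mul, one_div_mul_cancel hr.ne', ENNReal.rpow_one] at hH
  simp_rw [← ENNReal.rpow_mul] at hH
  rw [one_div_mul_cancel (by positivity), one_div_mul_cancel (by positivity)] at hH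
  simp_rw [ENNReal.rpow_one, one_div_mul_eq_div] at hH
  calc _ ≤ ∫⁻ x, (c * (S x ^ (1 / (2 * s)) * U x ^ (1 / (2 * u)))) ^ r ∂μ := by
        gcongr with x; exact hpt x
    _ = c ^ r * ∫⁻ x, (S x ^ (1 / (2 * s)) * U x ^ (1 / (2 * u))) ^ r ∂μ := by
        simp_rw [ENNReal.mul_rpow_of_nonneg c _ hr.le]
        rw [lintegral_const_mul' _ _ (ENNReal.rpow_ne_top_of_nonneg hr.le hct)]
    _ ≤ c ^ r * ((∫⁻ x, S x ∂μ) ^ (r / (2 * s)) * (∫⁻ x, U x ∂μ) ^ (r / (2 * u))) := by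
        gcongr
    _ ≤ c ^ r * ((C₁ * ((∫⁻ x, f x ^ p ∂μ) ^ (s / p) * (∫⁻ x, g x ^ q ∂μ) ^ (s / q))) ^
          (r / (2 * s)) * (C₂ * ((∫⁻ x, f x ^ p ∂μ) ^ (u / p) * (∫⁻ x, g x ^ q ∂μ) ^ (u / q))) ^
          (r / (2 * u))) := by gcongr
    _ = _ := by
        have hsplit : ∀ (N : ℝ≥0∞) {e : ℝ}, 0 < e →
            N ^ (r / e) = N ^ (s / e * (r / (2 * s))) * N ^ (u / e * (r / (2 * u))) :=
          fun N e he => by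
            rw [← ENNReal.rpow_add_of_nonneg _ _ (by positivity) (by positivity)]
            congr 1; field_simp; norm_num
        have h1 : 0 ≤ r / (2 * s) := by positivity
        have h2 : 0 ≤ r / (2 * u) := by positivity
        rw [hsplit _ hp0, hsplit _ hq0]
        simp only [ENNReal.mul_rpow_of_nonneg _ _ h1, ENNReal.mul_rpow_of_nonneg _ _ h2,
          ← ENNReal.rpow_mul]
        ring

end BilinearIntegral

/-! ### Almost everywhere defined and scalar-valued functions -/

section Transfer

variable {E : Type*} [NormedAddCommGroup E] [NormedSpace ℝ E] [FiniteDimensional ℝ E]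
  [MeasurableSpace E] [BorelSpace E] (μ : Measure E) [μ.IsAddHaarMeasure]

/-- Almost everywhere equal functions remain so along almost every line `y ↦ x + c • y`. For `c ≠ 0`
every `x` would do, but `c = 0` is needed too. -/
lemma ae_ae_eq_comp_add_smul {β : Type*} {f f' : E → β} (h : f =ᵐ[μ] f') (c : ℝ) :
    ∀ᵐ x ∂μ, ∀ᵐ y ∂μ, f (x + c • y) = f' (x + c • y) := by
  obtain ⟨t, hst, htm, ht⟩ := exists_measurable_superset_of_null (ae_iff.1 h)
  have hind : Measurable (t.indicator fun _ => (1 : ℝ≥0∞)) := measurable_const.indicator htm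
  have h0 : ∫⁻ x, ∫⁻ y, t.indicator (fun _ => (1 : ℝ≥0∞)) (x + c • y) ∂μ ∂μ = 0 := by
    rw [lintegral_lintegral_swap (by fun_prop)]
    simp_rw [lintegral_add_right_eq_self (t.indicator fun _ => (1 : ℝ≥0∞))]
    simp [lintegral_indicator htm, ht]
  have hm : Measurable fun x => ∫⁻ y, t.indicator (fun _ => (1 : ℝ≥0∞)) (x + c • y) ∂μ :=
    Measurable.lintegral_prod_right'
      (f := fun z : E × E => t.indicator (fun _ => (1 : ℝ≥0∞)) (z.1 + c • z.2)) (by fun_prop)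
  filter_upwards [(lintegral_eq_zero_iff hm).1 h0] with x hx
  filter_upwards [(lintegral_eq_zero_iff (by fun_prop)).1 hx] with y hy
  by_contra hne
  have : x + c • y ∈ t := hst hne
  simp [this] at hy

end Transfer

variable {d : ℕ}

lemma lbilinFracInt_congr_ae {α θ : ℝ} {f f' g g' : EuclideanSpace ℝ (Fin d) → ℝ≥0∞}
    (hf : f =ᵐ[volume] f') (hg : g =ᵐ[volume] g') :
    lbilinFracInt α θ f g =ᵐ[volume] lbilinFracInt α θ f' g' := by
  filter_upwards [ae_ae_eq_comp_add_smul volume hf (θ - 1),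
    ae_ae_eq_comp_add_smul volume hg θ] with x hx1 hx2
  refine lintegral_congr_ae ?_
  filter_upwards [hx1, hx2] with y h1 h2
  rw [h1, h2]

lemma measurable_lbilinFracInt {α θ : ℝ} {f g : EuclideanSpace ℝ (Fin d) → ℝ≥0∞}
    (hf : Measurable f) (hg : Measurable g) : Measurable (lbilinFracInt α θ f g) :=
  Measurable.lintegral_prod_right' (f := fun z : EuclideanSpace ℝ (Fin d) ×
    EuclideanSpace ℝ (Fin d) => f (z.1 + (θ - 1) • z.2) * g (z.1 + θ • z.2) * ‖z.2‖ₑ ^ (α - d))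
    (by fun_prop)

section RCLike

variable {𝕜 : Type*} [RCLike 𝕜]

lemma bilinFracIntegrand_congr_ae {α θ : ℝ} {f f' g g' : EuclideanSpace ℝ (Fin d) → 𝕜}
    (hf : f =ᵐ[volume] f') (hg : g =ᵐ[volume] g') :
    ∀ᵐ x, bilinFracIntegrand α θ f g x =ᵐ[volume] bilinFracIntegrand α θ f' g' x := by
  filter_upwards [ae_ae_eq_comp_add_smul volume hf (θ - 1),
    ae_ae_eq_comp_add_smul volume hg θ] with x hx1 hx2
  filter_upwards [hx1, hx2] with y h1 h2
  rw [bilinFracIntegrand, bilinFracIntegrand, h1, h2]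

lemma measurable_uncurry_bilinFracIntegrand {α θ : ℝ} {f g : EuclideanSpace ℝ (Fin d) → 𝕜}
    (hf : Measurable f) (hg : Measurable g) :
    Measurable (Function.uncurry (bilinFracIntegrand α θ f g)) := by
  have : Measurable fun y : EuclideanSpace ℝ (Fin d) => ((‖y‖ ^ (α - d) : ℝ) : 𝕜) :=
    RCLike.measurable_ofReal.comp (by fun_prop)
  unfold Function.uncurry bilinFracIntegrand
  fun_prop

lemma enorm_bilinFracIntegrand {α θ : ℝ} (f g : EuclideanSpace ℝ (Fin d) → 𝕜)
    (x : EuclideanSpace ℝ (Fin d)) {y : EuclideanSpace ℝ (Fin d)} (hy : y ≠ 0) :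
    ‖bilinFracIntegrand α θ f g x y‖ₑ =
      ‖f (x + (θ - 1) • y)‖ₑ * ‖g (x + θ • y)‖ₑ * ‖y‖ₑ ^ (α - d) := by
  have hy' : 0 < ‖y‖ := norm_pos_iff.2 hy
  rw [bilinFracIntegrand, enorm_mul, enorm_mul, ← ofReal_norm ((‖y‖ ^ (α - d) : ℝ) : 𝕜),
    RCLike.norm_ofReal, abs_of_nonneg (by positivity), ← ENNReal.ofReal_rpow_of_pos hy',
    ofReal_norm]

/-- The absolute value of the integrand integrates to the bilinear integral of `‖f‖ₑ` and `‖g‖ₑ`.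
For `α < d` the two kernels differ at `y = 0`, where the real power is `0` and the extended one is
`∞`; this point is negligible unless `d = 0`. -/
lemma lintegral_enorm_bilinFracIntegrand [NeZero d] {α θ : ℝ}
    (f g : EuclideanSpace ℝ (Fin d) → 𝕜) (x : EuclideanSpace ℝ (Fin d)) :
    ∫⁻ y, ‖bilinFracIntegrand α θ f g x y‖ₑ =
      lbilinFracInt α θ (fun z => ‖f z‖ₑ) (fun z => ‖g z‖ₑ) x := by
  refine lintegral_congr_ae ?_
  filter_upwards [Measure.ae_ne volume 0] with y hy
  exact enorm_bilinFracIntegrand f g x hy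

lemma aestronglyMeasurable_bilinFracInt {α θ : ℝ} {f g : EuclideanSpace ℝ (Fin d) → 𝕜}
    (hf : AEStronglyMeasurable f volume) (hg : AEStronglyMeasurable g volume) :
    AEStronglyMeasurable (bilinFracInt α θ f g) volume := by
  refine ⟨bilinFracInt α θ (hf.mk f) (hg.mk g), ?_, ?_⟩
  · exact (measurable_uncurry_bilinFracIntegrand hf.stronglyMeasurable_mk.measurable
      hg.stronglyMeasurable_mk.measurable).stronglyMeasurable.integral_prod_right
  · filter_upwards [bilinFracIntegrand_congr_ae hf.ae_eq_mk hg.ae_eq_mk] with x hx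
    exact integral_congr_ae hx

lemma ae_aestronglyMeasurable_bilinFracIntegrand {α θ : ℝ}
    {f g : EuclideanSpace ℝ (Fin d) → 𝕜} (hf : AEStronglyMeasurable f volume)
    (hg : AEStronglyMeasurable g volume) :
    ∀ᵐ x, AEStronglyMeasurable (bilinFracIntegrand α θ f g x) volume := by
  filter_upwards [bilinFracIntegrand_congr_ae (α := α) (θ := θ) hf.ae_eq_mk hg.ae_eq_mk] with x hx
  refine ⟨bilinFracIntegrand α θ (hf.mk f) (hg.mk g) x, ?_, hx⟩
  exact ((measurable_uncurry_bilinFracIntegrand hf.stronglyMeasurable_mk.measurable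
    hg.stronglyMeasurable_mk.measurable).comp measurable_prodMk_left).stronglyMeasurable

end RCLike

lemma eLpNorm_ofReal_eq {Ω ε : Type*} [MeasurableSpace Ω] [TopologicalSpace ε]
    [ContinuousENorm ε] (f : Ω → ε) {p : ℝ} (hp : 0 < p) (μ : Measure Ω) :
    eLpNorm f (ENNReal.ofReal p) μ = (∫⁻ x, ‖f x‖ₑ ^ p ∂μ) ^ (1 / p) := by
  rw [eLpNorm_eq_lintegral_rpow_enorm_toReal (by simpa using hp) ENNReal.ofReal_ne_top,
    ENNReal.toReal_ofReal hp.le]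

lemma exists_eLpNorm_lbilinFracInt_le [NeZero d] {α p q r : ℝ} (hα : 0 < α) (hαd : α < d)
    (hp : 1 < p) (hq : 1 < q) (hαp : α / d < 1 / p) (hαq : α / d < 1 / q) (hr : 0 < r)
    (h : 1 / r = 1 / p + 1 / q - α / d) :
    ∃ C : ℝ, 0 < C ∧ ∀ θ ∈ Set.Icc (0 : ℝ) 1, ∀ f g : EuclideanSpace ℝ (Fin d) → ℝ≥0∞,
      AEMeasurable f volume → AEMeasurable g volume →
        eLpNorm (lbilinFracInt α θ f g) (ENNReal.ofReal r) volume ≤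
          ENNReal.ofReal C * eLpNorm f (ENNReal.ofReal p) volume *
            eLpNorm g (ENNReal.ofReal q) volume := by
  have hfin : (finrank ℝ (EuclideanSpace ℝ (Fin d)) : ℝ) = d := by simp
  obtain ⟨K, hK, hle⟩ := exists_lintegral_bilinFracInt_rpow_le
    (volume : Measure (EuclideanSpace ℝ (Fin d))) hα (by rwa [hfin]) hp hq (by rwa [hfin])
    (by rwa [hfin]) hr (by rwa [hfin])
  rw [hfin] at hle
  have hr' : 0 ≤ 1 / r := by positivity
  have hKr : K ^ (1 / r) ≠ ∞ := ENNReal.rpow_ne_top_of_nonneg hr' hK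
  refine ⟨(K ^ (1 / r)).toReal + 1, by positivity, fun θ hθ f g hf hg => ?_⟩
  rw [eLpNorm_congr_ae (lbilinFracInt_congr_ae hf.ae_eq_mk hg.ae_eq_mk),
    eLpNorm_congr_ae hf.ae_eq_mk, eLpNorm_congr_ae hg.ae_eq_mk, eLpNorm_ofReal_eq _ hr,
    eLpNorm_ofReal_eq _ (by linarith), eLpNorm_ofReal_eq _ (by linarith)]
  simp only [enorm_eq_self]
  calc _ ≤ (K * ((∫⁻ x, hf.mk f x ^ p) ^ (r / p) * (∫⁻ x, hg.mk g x ^ q) ^ (r / q))) ^ (1 / r) :=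
        ENNReal.rpow_le_rpow (hle θ hθ _ _ hf.measurable_mk hg.measurable_mk) hr'
    _ = K ^ (1 / r) * (∫⁻ x, hf.mk f x ^ p) ^ (1 / p) * (∫⁻ x, hg.mk g x ^ q) ^ (1 / q) := by
        rw [ENNReal.mul_rpow_of_nonneg _ _ hr', ENNReal.mul_rpow_of_nonneg _ _ hr',
          ← ENNReal.rpow_mul, ← ENNReal.rpow_mul, ← mul_assoc]
        have e : ∀ s : ℝ, r / s * (1 / r) = 1 / s := fun s => by field_simp
        rw [e, e]
    _ ≤ _ := by
        gcongr
        rw [← ENNReal.ofReal_toReal hKr]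
        exact ENNReal.ofReal_le_ofReal (by simp)

end Auxiliary

theorem mainTheorem1 (d : ℕ) (α p q r : ℝ) (hα : 0 < α) (hαd : α < d)
    (hp : 1 < p) (hpd : p < d / α) (hq : 1 < q) (hqd : q < d / α)
    (hr : 1 / p + 1 / q = 1 / r + α / d) :
    ∃ C : ℝ, 0 < C ∧ ∀ θ ∈ Set.Icc (0 : ℝ) 1,
      -- nonnegative functions
      (∀ f g : EuclideanSpace ℝ (Fin d) → ℝ≥0∞,
        MemLp f (ENNReal.ofReal p) volume → MemLp g (ENNReal.ofReal q) volume →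
          MemLp (lbilinFracInt α θ f g) (ENNReal.ofReal r) volume ∧
          eLpNorm (lbilinFracInt α θ f g) (ENNReal.ofReal r) volume ≤
            ENNReal.ofReal C * eLpNorm f (ENNReal.ofReal p) volume *
              eLpNorm g (ENNReal.ofReal q) volume) ∧
      -- real- or complex-valued functions
      (∀ (𝕜 : Type) [RCLike 𝕜] (f g : EuclideanSpace ℝ (Fin d) → 𝕜),
        MemLp f (ENNReal.ofReal p) volume → MemLp g (ENNReal.ofReal q) volume →
          (∀ᵐ x, Integrable (bilinFracIntegrand α θ f g x) volume) ∧
          MemLp (bilinFracInt α θ f g) (ENNReal.ofReal r) volume ∧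
          eLpNorm (bilinFracInt α θ f g) (ENNReal.ofReal r) volume ≤
            ENNReal.ofReal C * eLpNorm f (ENNReal.ofReal p) volume *
              eLpNorm g (ENNReal.ofReal q) volume) := by
  have hd0 : (0 : ℝ) < d := hα.trans hαd
  have : NeZero d := ⟨by rintro rfl; simp at hd0⟩
  have hαp : α / d < 1 / p := by
    rw [← one_div_div]; exact one_div_lt_one_div_of_lt (by linarith) hpd
  have hαq : α / d < 1 / q := by
    rw [← one_div_div]; exact one_div_lt_one_div_of_lt (by linarith) hqd
  have hr0 : 0 < r := by
    have : 0 < 1 / p := by positivity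
    exact one_div_pos.1 (by linarith)
  obtain ⟨C, hC, h⟩ := exists_eLpNorm_lbilinFracInt_le hα hαd hp hq hαp hαq hr0 (by linarith)
  have hL : ∀ θ ∈ Set.Icc (0 : ℝ) 1, ∀ f g : EuclideanSpace ℝ (Fin d) → ℝ≥0∞,
      MemLp f (ENNReal.ofReal p) volume → MemLp g (ENNReal.ofReal q) volume →
      MemLp (lbilinFracInt α θ f g) (ENNReal.ofReal r) volume := by
    intro θ hθ f g hf hg
    have hfm := hf.1.aemeasurable
    have hgm := hg.1.aemeasurable
    refine ⟨?_, (h θ hθ f g hfm hgm).trans_lt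
      (ENNReal.mul_lt_top (ENNReal.mul_lt_top ENNReal.ofReal_lt_top hf.2) hg.2)⟩
    exact AEMeasurable.aestronglyMeasurable ⟨_, measurable_lbilinFracInt hfm.measurable_mk
      hgm.measurable_mk, lbilinFracInt_congr_ae hfm.ae_eq_mk hgm.ae_eq_mk⟩
  refine ⟨C, hC, fun θ hθ => ⟨fun f g hf hg => ⟨hL θ hθ f g hf hg,
    h θ hθ f g hf.1.aemeasurable hg.1.aemeasurable⟩, fun 𝕜 _ f g hf hg => ?_⟩⟩
  set F : EuclideanSpace ℝ (Fin d) → ℝ≥0∞ := fun z => ‖f z‖ₑ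
  set G : EuclideanSpace ℝ (Fin d) → ℝ≥0∞ := fun z => ‖g z‖ₑ
  have hF : MemLp F (ENNReal.ofReal p) volume := hf.enorm
  have hG : MemLp G (ENNReal.ofReal q) volume := hg.enorm
  have hI := hL θ hθ F G hF hG
  have hIfin : ∀ᵐ x, lbilinFracInt α θ F G x < ∞ := by
    have h1 := hI.2
    rw [eLpNorm_ofReal_eq _ hr0, ENNReal.rpow_lt_top_iff_of_pos (by positivity)] at h1
    filter_upwards [ae_lt_top' (hI.1.aemeasurable.pow_const r) h1.ne] with x hx
    exact (ENNReal.rpow_lt_top_iff_of_pos hr0).1 hx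
  have hle : eLpNorm (bilinFracInt α θ f g) (ENNReal.ofReal r) volume ≤
      ENNReal.ofReal C * eLpNorm f (ENNReal.ofReal p) volume *
        eLpNorm g (ENNReal.ofReal q) volume := by
    calc _ ≤ eLpNorm (lbilinFracInt α θ F G) (ENNReal.ofReal r) volume :=
          eLpNorm_mono_enorm fun x => (enorm_integral_le_lintegral_enorm _).trans_eq
            (lintegral_enorm_bilinFracIntegrand f g x)
      _ ≤ _ := by
          have := h θ hθ F G hF.1.aemeasurable hG.1.aemeasurable
          rwa [eLpNorm_enorm, eLpNorm_enorm] at this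
  refine ⟨?_, ⟨aestronglyMeasurable_bilinFracInt hf.1 hg.1, hle.trans_lt
    (ENNReal.mul_lt_top (ENNReal.mul_lt_top ENNReal.ofReal_lt_top hf.2) hg.2)⟩, hle⟩
  filter_upwards [hIfin, ae_aestronglyMeasurable_bilinFracIntegrand hf.1 hg.1] with x hx hxm
  exact ⟨hxm, by rwa [HasFiniteIntegral, lintegral_enorm_bilinFracIntegrand]⟩
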